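/- Let $k$ be an algebraically closed field. Let $G$ be a finite nonabelian simple group and let $\gamma\colon H \to G$ be a finite minimal extension of $G$, that is, a surjective homomorphism from a finite group $H$ such that $\gamma(K) \neq G$ for every proper subgroup $K < H$. Let $\lambda\colon H \to \mathrm{PGL}_m(k)$ be an irreducible projective representation, that is, a homomorphism such that the preimage of $\lambda(H)$ in $\mathrm{GL}_m(k)$ acts irreducibly on $k^m$. Write $P(G)$ for the minimal $d$ such that $G$ is isomorphic to a subgroup of the symmetric group $S_d$, and $n_G$ for the minimal $n$ such that $G$ is isomorphic to an irreducible subgroup of $\mathrm{Sp}_{2n}(2)$. Assume that $m < P(G)$ and, if $\mathrm{char}\, k \neq 2$, that also $m < 2^{n_G}$. Then $\ker\gamma \leq \ker\lambda$. -/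

import Mathlib

open scoped MatrixGroups

noncomputable section

/-- A finite minimal extension of `G`: a surjective homomorphism `γ : H → G` from a finite
group `H` such that every proper subgroup of `H` has a proper image in `G`. -/
structure IsFiniteMinimalExtension {G H : Type*} [Group G] [Group H] (γ : H →* G) : Prop where
  finite : Finite H
  surjective : Function.Surjective γ
  map_lt_top : ∀ K : Subgroup H, K < ⊤ → K.map γ < ⊤

/-- The representation on column vectors given by a homomorphism to square matrices. -/
def matrixRep {M ι F : Type*} [Monoid M] [Fintype ι] [DecidableEq ι] [Field F]
    (f : M →* Matrix ι ι F) : Representation F M (ι → F) :=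
  (Matrix.toLinAlgEquiv' : Matrix ι ι F ≃ₐ[F] Module.End F (ι → F)).toMonoidHom.comp f

theorem matrixRep_apply {M ι F : Type*} [Monoid M] [Fintype ι] [DecidableEq ι] [Field F]
    (f : M →* Matrix ι ι F) (g : M) (v : ι → F) :
    matrixRep f g v = Matrix.mulVec (f g) v := rfl

/-- `P(G)`: the minimal `d` such that `G` embeds in the symmetric group of degree `d`. -/
def minPermDegree (G : Type*) [Group G] : ℕ :=
  sInf {d : ℕ | ∃ φ : G →* Equiv.Perm (Fin d), Function.Injective φ}

/-- `G` is isomorphic to an irreducible subgroup of `Sp_{2n}(2)`. -/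
def EmbedsIrreduciblyInSp (G : Type*) [Group G] (n : ℕ) : Prop :=
  ∃ ρ : G →* Matrix.symplecticGroup (Fin n) (ZMod 2), Function.Injective ρ ∧
    (matrixRep ((Matrix.symplecticGroup (Fin n) (ZMod 2)).subtype.comp ρ)).IsIrreducible

/-- `n_G`: the minimal `n` such that `G` is isomorphic to an irreducible subgroup of
`Sp_{2n}(2)`. (Such an `n` exists for every finite nonabelian simple group.) -/
def minSympRank (G : Type*) [Group G] : ℕ :=
  sInf {n : ℕ | EmbedsIrreduciblyInSp G n}

/-- The full preimage in `GL_m(k)` of the image of a projective representation. -/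
def projPreimage {H k : Type*} [Group H] [Field k] {m : ℕ} (lam : H →* PGL(m, k)) :
    Subgroup (GL (Fin m) k) :=
  lam.range.comap Matrix.ProjGenLinGroup.mk

/-- A projective representation `H → PGL_m(k)` is irreducible if the preimage of its image in
`GL_m(k)` acts irreducibly on `k^m` (in particular `m ≠ 0`). -/
def IsIrreducibleProj {H k : Type*} [Group H] [Field k] {m : ℕ} (lam : H →* PGL(m, k)) : Prop :=
  (matrixRep ((Units.coeHom (Matrix (Fin m) (Fin m) k)).comp
    (projPreimage lam).subtype)).IsIrreducible

end

/-! Dividing by `γ.ker ⊓ lam.ker` reduces to the case where this intersection is trivial; suppose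
then that `N = γ.ker` is not. Minimality puts `N` inside the Frattini subgroup, so `N` is nilpotent
and contains an elementary abelian `r`-subgroup `M`, central in `N` and minimal normal in `H`. Pull
`lam` back to a linear representation of a central extension `Γ` of `H` by `kˣ`, and let `A` be the
preimage of `M`. Commutators in `A` give an alternating `H`-invariant pairing `b : M × M → kˣ`,
whose radical is trivial or all of `M`.

If `b = 1`, then `A` acts through commuting operators. It has at most `m < P(G)` characters in a
`Γ`-orbit, so minimality makes `Γ` fix a character, and irreducibility makes `A` scalar
(`isScalar_of_commuting_normal`). Thus `M ≤ lam.ker`, a contradiction.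

If `b` is nondegenerate and `r` is odd, Baer's trick yields a proper supplement of `A` in `Γ`
(`exists_supplement_of_pairing`), against minimality. If `r = 2`, then `M` is a faithful irreducible
symplectic `G`-module of order `2 ^ (2 * n)`, and coset representatives of `M` act by independent
operators, so `2 ^ n ≤ m` (`card_le_finrank_sq_of_pairing`), against `m < 2 ^ n_G`. -/

/-! ### Permutation degree, characters and commuting normal subgroups -/

theorem minPermDegree_le_index {G : Type*} [Group G] [Finite G] [IsSimpleGroup G]
    (K : Subgroup G) (hK : K ≠ ⊤) : minPermDegree G ≤ K.index := by
  have hcore : K.normalCore = ⊥ := by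
    refine (IsSimpleGroup.eq_bot_or_eq_top_of_normal _ K.normalCore_normal).resolve_right fun h => ?_
    exact hK (top_le_iff.mp (h ▸ K.normalCore_le))
  have e : (G ⧸ K) ≃ Fin K.index := Finite.equivFin (G ⧸ K)
  refine Nat.sInf_le ⟨(e.permCongrHom.toMonoidHom).comp (MulAction.toPermHom G (G ⧸ K)), ?_⟩
  rw [MonoidHom.coe_comp]
  refine e.permCongrHom.injective.comp ?_
  rw [← MonoidHom.ker_eq_bot_iff, ← Subgroup.normalCore_eq_ker, hcore]

/-- A functional nonzero on `v i` turns a linear relation into a relation between distinct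
characters, which Dedekind's lemma excludes. The maps `T a` need not be multiplicative in `a`. -/
theorem linearIndependent_of_characters {A k W ι : Type*} [Monoid A] [Field k] [AddCommGroup W]
    [Module k W] (χ : ι → A →* k) (hχ : Function.Injective χ) (T : A → W →ₗ[k] W) (v : ι → W)
    (hv : ∀ i, v i ≠ 0) (h : ∀ i a, T a (v i) = χ i a • v i) : LinearIndependent k v := by
  have hind := (linearIndependent_monoidHom A k).comp χ hχ
  rw [linearIndependent_iff'] at hind ⊢
  intro s c hc i hi
  obtain ⟨φ, hφ⟩ : ∃ φ : Module.Dual k W, φ (v i) ≠ 0 := by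
    by_contra! hcon
    exact hv i ((Module.forall_dual_apply_eq_zero_iff k _).mp hcon)
  have key := hind s (fun j => c j * φ (v j)) ?_ i hi
  · exact (mul_eq_zero.mp key).resolve_right hφ
  · funext a
    have := congrArg (fun w => φ (T a w)) hc
    simp only [map_sum, map_smul, h, map_zero, smul_eq_mul] at this
    simp only [Finset.sum_apply, Pi.smul_apply, Function.comp_apply, smul_eq_mul, Pi.zero_apply]
    rw [← this]
    exact Finset.sum_congr rfl fun j _ => by ring

theorem exists_common_eigenvector {A k V : Type*} [Monoid A] [Field k] [IsAlgClosed k]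
    [AddCommGroup V] [Module k V] [FiniteDimensional k V] [Nontrivial V]
    (ρ : A →* Module.End k V) (hcomm : ∀ a b, Commute (ρ a) (ρ b)) :
    ∃ (χ : A →* k) (v : V), v ≠ 0 ∧ ∀ a, ρ a v = χ a • v := by
  obtain ⟨W, ⟨hW0, hW⟩, hmin⟩ := WellFounded.has_min (wellFounded_lt (α := Submodule k V))
    {W | W ≠ ⊥ ∧ ∀ a, ∀ w ∈ W, ρ a w ∈ W} ⟨⊤, by simp⟩
  have hscalar : ∀ a, ∃ c : k, ∀ w ∈ W, ρ a w = c • w := by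
    intro a
    have : Nontrivial W := Submodule.nontrivial_iff_ne_bot.mpr hW0
    obtain ⟨c, hc⟩ := Module.End.exists_eigenvalue ((ρ a).restrict (hW a))
    obtain ⟨w, hw⟩ := hc.exists_hasEigenvector
    refine ⟨c, ?_⟩
    by_contra! hcon
    obtain ⟨u, huW, hu⟩ := hcon
    refine hmin (W ⊓ Module.End.eigenspace (ρ a) c) ⟨?_, ?_⟩ (lt_of_le_of_ne inf_le_left ?_)
    · rw [Submodule.ne_bot_iff]
      refine ⟨w, ⟨w.2, ?_⟩, by simpa using hw.2⟩
      rw [SetLike.mem_coe, Module.End.mem_eigenspace_iff]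
      exact congrArg Subtype.val hw.apply_eq_smul
    · rintro b x ⟨hxW, hx⟩
      refine ⟨hW b x hxW, ?_⟩
      rw [SetLike.mem_coe, Module.End.mem_eigenspace_iff] at hx ⊢
      have := congrArg (fun f : Module.End k V => f x) (hcomm a b).eq
      simp only [Module.End.mul_apply] at this
      rw [this, hx, map_smul]
    · intro heq
      exact hu (Module.End.mem_eigenspace_iff.mp (heq.symm ▸ huW : u ∈ W ⊓ _).2)
  choose c hc using hscalar
  obtain ⟨v, hvW, hv⟩ := W.ne_bot_iff.mp hW0
  refine ⟨⟨⟨c, ?_⟩, ?_⟩, v, hv, fun a => hc a v hvW⟩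
  · have := hc 1 v hvW
    rw [map_one, Module.End.one_apply] at this
    refine smul_left_injective k hv ?_
    simpa using this.symm
  · intro a b
    refine smul_left_injective k hv ?_
    change c (a * b) • v = (c a * c b) • v
    rw [← hc _ v hvW, map_mul, Module.End.mul_apply, hc b v hvW, map_smul, hc a v hvW, smul_smul,
      mul_comm]

/-- Clifford's argument: the conjugates of a character `χ` occurring in `V` have independent
eigenvectors, so the stabilizer of `χ` has index at most `dim V`, and `hS` makes it everything. The
`χ`-eigenspace is then invariant, hence all of `V`. -/
theorem isScalar_of_commuting_normal {Γ k V : Type*} [Group Γ] [Field k] [IsAlgClosed k]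
    [AddCommGroup V] [Module k V] [FiniteDimensional k V] [Nontrivial V]
    (ρ : Γ →* Module.End k V)
    (hirr : ∀ W : Submodule k V, (∀ g, ∀ w ∈ W, ρ g w ∈ W) → W = ⊥ ∨ W = ⊤)
    (A : Subgroup Γ) [A.Normal] (hA : ∀ x ∈ A, ∀ y ∈ A, Commute (ρ x) (ρ y))
    (hS : ∀ S : Subgroup Γ, (∀ g, (∃ z : k, ρ g = z • 1) → g ∈ S) → S.index ≠ 0 →
      S.index ≤ Module.finrank k V → S = ⊤) :
    ∀ a ∈ A, ∃ z : k, ρ a = z • 1 := by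
  obtain ⟨χ, v, hv, hχ⟩ := exists_common_eigenvector (ρ.comp A.subtype)
    (fun a b => hA a a.2 b b.2)
  replace hχ : ∀ a : A, ρ a v = χ a • v := hχ
  let act : MulAction Γ (A →* k) :=
    { smul := fun g ψ => ψ.comp (MulAut.conjNormal g⁻¹ : MulAut A).toMonoidHom
      one_smul := fun ψ => by
        ext x
        change ψ ((MulAut.conjNormal (1 : Γ)⁻¹ : MulAut A) x) = ψ x
        simp
      mul_smul := fun g h ψ => by
        ext x
        change ψ ((MulAut.conjNormal (g * h)⁻¹ : MulAut A) x) =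
          ψ ((MulAut.conjNormal h⁻¹ : MulAut A) ((MulAut.conjNormal g⁻¹ : MulAut A) x))
        simp }
  have smul_apply (g : Γ) (ψ : A →* k) (x : A) :
      (g • ψ) x = ψ ((MulAut.conjNormal g⁻¹ : MulAut A) x) := rfl
  have heig (g : Γ) (x : A) : ρ x (ρ g v) = (g • χ) x • ρ g v := by
    rw [smul_apply, ← map_smul, ← hχ, ← Module.End.mul_apply, ← Module.End.mul_apply, ← map_mul,
      ← map_mul, MulAut.conjNormal_apply]
    congr 2
    group
  have hne (g : Γ) : ρ g v ≠ 0 := by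
    intro h
    apply hv
    have : ρ (g⁻¹ * g) v = 0 := by rw [map_mul, Module.End.mul_apply, h, map_zero]
    simpa using this
  have hex : ∀ ψ : MulAction.orbit Γ χ, ∃ w : V, w ≠ 0 ∧ ∀ x : A, ρ x w = (ψ : A →* k) x • w := by
    rintro ⟨ψ, g, rfl⟩
    exact ⟨ρ g v, hne g, heig g⟩
  choose w hw0 hw using hex
  have hli : LinearIndependent k w :=
    linearIndependent_of_characters (fun ψ : MulAction.orbit Γ χ => (ψ : A →* k))
      Subtype.val_injective (fun a : A => ρ a) w hw0 hw
  have hfin : Finite (MulAction.orbit Γ χ) := hli.finite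
  have hstab : MulAction.stabilizer Γ χ = ⊤ := by
    apply hS
    · rintro g ⟨z, hz⟩
      rw [MulAction.mem_stabilizer_iff]
      ext x
      refine smul_left_injective k (hne g) ?_
      change (g • χ) x • ρ g v = χ x • ρ g v
      rw [← heig g x, hz]
      simp only [LinearMap.smul_apply, Module.End.one_apply, map_smul]
      rw [hχ, smul_comm]
    · rw [MulAction.index_stabilizer]
      exact (Set.ncard_pos (Set.toFinite _)).mpr (MulAction.nonempty_orbit _) |>.ne'
    · rw [MulAction.index_stabilizer, ← Nat.card_coe_set_eq]
      have := Fintype.ofFinite (MulAction.orbit Γ χ)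
      rw [Nat.card_eq_fintype_card]
      exact hli.fintype_card_le_finrank
  have hg (g : Γ) : g • χ = χ := by
    rw [← MulAction.mem_stabilizer_iff, hstab]
    trivial
  let W : Submodule k V := ⨅ a : A, Module.End.eigenspace (ρ a) (χ a)
  have memW (u : V) : u ∈ W ↔ ∀ a : A, ρ a u = χ a • u := by
    simp [W, Submodule.mem_iInf]
  have hW : W = ⊤ := by
    refine (hirr W ?_).resolve_left ?_
    · intro g u hu
      rw [memW] at hu ⊢
      intro a
      have := hu ((MulAut.conjNormal g⁻¹ : MulAut A) a)
      rw [← smul_apply, hg] at this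
      rw [← map_smul, ← this, ← Module.End.mul_apply, ← Module.End.mul_apply, ← map_mul,
        ← map_mul, MulAut.conjNormal_apply]
      congr 2
      group
    · exact W.ne_bot_iff.mpr ⟨v, (memW v).mpr hχ, hv⟩
  intro a ha
  refine ⟨χ ⟨a, ha⟩, LinearMap.ext fun u => ?_⟩
  exact (memW u).mp (hW ▸ Submodule.mem_top) ⟨a, ha⟩

theorem isIrreducible_iff_forall_submodule {A k V : Type*} [Monoid A] [Field k] [AddCommGroup V]
    [Module k V] (ρ : Representation k A V) :
    ρ.IsIrreducible ↔ Nontrivial V ∧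
      ∀ W : Submodule k V, (∀ g, ∀ w ∈ W, ρ g w ∈ W) → W = ⊥ ∨ W = ⊤ := by
  have hbot (W : Subrepresentation ρ) : W = ⊥ ↔ W.toSubmodule = ⊥ :=
    Subrepresentation.toSubmodule_injective.eq_iff (b := (⊥ : Subrepresentation ρ)).symm
  have htop (W : Subrepresentation ρ) : W = ⊤ ↔ W.toSubmodule = ⊤ :=
    Subrepresentation.toSubmodule_injective.eq_iff (b := (⊤ : Subrepresentation ρ)).symm
  have hnt : Nontrivial (Subrepresentation ρ) ↔ Nontrivial V := by
    rw [← Submodule.nontrivial_iff k (M := V)]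
    constructor <;> intro h
    · exact (Subrepresentation.toSubmodule_injective (ρ := ρ)).nontrivial
    · refine ⟨⊥, ⊤, fun h' => bot_ne_top (α := Submodule k V) ((htop ⊥).mp h')⟩
  rw [Representation.IsIrreducible, isSimpleOrder_iff, hnt]
  refine and_congr_right fun _ => ⟨fun h W hW => ?_, fun h W => ?_⟩
  · have := h ⟨W, fun g v hv => hW g v hv⟩
    rwa [hbot, htop] at this
  · rw [hbot, htop]
    exact h _ fun g v hv => W.apply_mem_toSubmodule g hv

/-! ### Commutator pairings and Baer's trick -/

theorem exists_commutator_pairing {A M Z : Type*} [Group A] [CommGroup M] [CommGroup Z]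
    (p : A →* M) (hp : Function.Surjective p) (ι : Z →* A) (hι : Function.Injective ι)
    (hrange : ι.range = p.ker) (hcen : ∀ z a, ι z * a = a * ι z) :
    ∃ b : M →* M →* Z, ∀ x y, x * y = ι (b (p x) (p y)) * (y * x) := by
  have hex : ∀ x y : A, ∃ z : Z, x * y = ι z * (y * x) := by
    intro x y
    obtain ⟨z, hz⟩ : x * y * (y * x)⁻¹ ∈ ι.range := by
      rw [hrange, MonoidHom.mem_ker, map_mul, map_inv, map_mul, map_mul, mul_comm (p y),
        mul_inv_cancel]
    exact ⟨z, by rw [hz, inv_mul_cancel_right]⟩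
  choose c hc using hex
  have huniq {x y : A} {z : Z} (h : x * y = ι z * (y * x)) : c x y = z :=
    hι (mul_right_cancel ((hc x y).symm.trans h))
  have hmul_left (x x' y : A) : c (x * x') y = c x y * c x' y := by
    apply huniq
    rw [mul_assoc, hc x' y, ← mul_assoc x, ← hcen, mul_assoc, ← mul_assoc x, hc x y, map_mul,
      mul_assoc (ι (c x y)), ← mul_assoc (ι (c x' y)), ← map_mul, ← map_mul, mul_comm (c x' y),
      mul_assoc y]
  have hsymm (x y : A) : c y x = (c x y)⁻¹ := by
    apply huniq
    rw [hc x y, ← mul_assoc, ← map_mul, inv_mul_cancel, map_one, one_mul]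
  have hker (x x' y : A) (h : p x = p x') : c x y = c x' y := by
    obtain ⟨z, hz⟩ : x * x'⁻¹ ∈ ι.range := by
      rw [hrange, MonoidHom.mem_ker, map_mul, map_inv, h, mul_inv_cancel]
    have hx : x = ι z * x' := by rw [hz, inv_mul_cancel_right]
    have h1 : c (ι z) y = 1 := huniq (by rw [map_one, one_mul, hcen])
    rw [hx, hmul_left, h1, one_mul]
  have hker' (x y y' : A) (h : p y = p y') : c x y = c x y' := by
    rw [hsymm y x, hker y y' x h, ← hsymm]
  have hmul_right (x y y' : A) : c x (y * y') = c x y * c x y' := by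
    rw [hsymm _ x, hmul_left, mul_inv, ← hsymm, ← hsymm]
  choose s hs using hp
  refine ⟨MonoidHom.mk' (fun m => MonoidHom.mk' (fun n => c (s m) (s n)) ?_) ?_, ?_⟩
  · intro n n'
    rw [← hmul_right]
    exact hker' _ _ _ (by simp [hs])
  · intro m m'
    ext n
    change c (s (m * m')) (s n) = c (s m) (s n) * c (s m') (s n)
    rw [← hmul_left]
    exact hker _ _ _ (by simp [hs])
  · intro x y
    change x * y = ι (c (s (p x)) (s (p y))) * (y * x)
    rw [hker _ x _ (hs _), hker' _ _ y (hs _)]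
    exact hc x y

theorem pairing_self {A M Z : Type*} [Group A] [CommGroup M] [CommGroup Z]
    (p : A →* M) (ι : Z →* A) (hι : Function.Injective ι) (b : M →* M →* Z)
    (hb : ∀ x y, x * y = ι (b (p x) (p y)) * (y * x)) (x : A) : b (p x) (p x) = 1 := by
  have := hb x x
  rw [eq_comm, mul_eq_right, ← map_one ι] at this
  exact hι this

theorem pairing_skew {A M Z : Type*} [Group A] [CommGroup M] [CommGroup Z]
    (p : A →* M) (ι : Z →* A) (hι : Function.Injective ι) (b : M →* M →* Z)
    (hb : ∀ x y, x * y = ι (b (p x) (p y)) * (y * x)) (x y : A) :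
    b (p y) (p x) = (b (p x) (p y))⁻¹ := by
  have := hb x y
  rw [hb y x, ← mul_assoc, ← map_mul, eq_comm, mul_eq_right, ← map_one ι] at this
  exact eq_inv_of_mul_eq_one_right (hι this)

theorem pairing_equivariant {A M Z : Type*} [Group A] [CommGroup M] [CommGroup Z]
    (p : A →* M) (ι : Z →* A) (hι : Function.Injective ι) (b : M →* M →* Z)
    (hb : ∀ x y, x * y = ι (b (p x) (p y)) * (y * x)) (α : MulAut A) (hα : ∀ z, α (ι z) = ι z)
    (x y : A) : b (p (α x)) (p (α y)) = b (p x) (p y) := by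
  have h1 := congrArg α (hb x y)
  rw [map_mul, map_mul, hα, map_mul, hb] at h1
  exact hι (mul_right_cancel h1)

/-- Baer's trick: since `e` acts as one half on the values of `b`, the operation `b(x, y)^(-e) * x *
y` makes `A` an abelian group containing `Z`. A divisible group is injective, so `Z` is a retract,
and the retraction is `t`. -/
theorem exists_quadratic_section {A M Z : Type*} [Group A] [CommGroup M] [CommGroup Z]
    (p : A →* M) (ι : Z →* A) (hι : Function.Injective ι)
    (hpι : ∀ z, p (ι z) = 1) (hcen : ∀ z a, ι z * a = a * ι z)
    (b : M →* M →* Z) (hb : ∀ x y, x * y = ι (b (p x) (p y)) * (y * x))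
    (hdiv : ∀ n : ℤ, n ≠ 0 → ∀ z : Z, ∃ w, w ^ n = z) (e : ℕ) (he : ∀ x y, b x y ^ (2 * e) = b x y) :
    ∃ t : A → Z, (∀ z, t (ι z) = z) ∧
      ∀ x y, t (x * y) = t x * t y * b (p x) (p y) ^ e := by
  have hself := pairing_self p ι hι b hb
  have hskew := pairing_skew p ι hι b hb
  let op : A → A → A := fun x y => ι ((b (p x) (p y)) ^ e)⁻¹ * (x * y)
  let _ : Add A := ⟨op⟩
  let _ : Zero A := ⟨1⟩
  let _ : Neg A := ⟨fun x => x⁻¹⟩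
  have op_assoc (x y z : A) : op (op x y) z = op x (op y z) := by
    simp only [op, map_mul, hpι, map_inv, one_mul, inv_one, MonoidHom.mul_apply, mul_pow]
    have h1 : x * ((ι (b (p y) (p z) ^ e))⁻¹ * (y * z)) =
        (ι (b (p y) (p z) ^ e))⁻¹ * (x * (y * z)) := by
      rw [← map_inv, ← mul_assoc x, ← hcen, mul_assoc]
    rw [h1]
    simp only [← mul_assoc, ← map_inv, ← map_mul]
    congr 4
    have h2 (u v w : Z) : (v * w)⁻¹ * u⁻¹ = (u * v)⁻¹ * w⁻¹ := by
      rw [mul_comm, ← mul_inv, ← mul_inv, mul_assoc]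
    exact h2 _ _ _
  have op_comm (x y : A) : op x y = op y x := by
    simp only [op]
    rw [hskew x y, hb x y, ← mul_assoc, ← map_mul]
    congr 2
    rw [inv_pow, inv_inv, inv_mul_eq_iff_eq_mul, ← pow_add, ← two_mul, he]
  let _ : AddCommGroup A :=
    { AddGroup.ofLeftAxioms op_assoc (fun x => by change op 1 x = x; simp [op])
        (fun x => by change op x⁻¹ x = 1; simp [op, hself]) with
      add_comm := op_comm }
  have add_def (x y : A) : x + y = op x y := rfl
  let j : Additive Z →+ A :=
    { toFun := fun z => ι z.toMul
      map_zero' := map_one ι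
      map_add' := fun z w => by
        rw [add_def]
        simp [op, hpι] }
  have hj : Function.Injective j := hι
  let dv : DivisibleBy (Additive Z) ℤ :=
    divisibleByOfSMulRightSurj (Additive Z) ℤ fun {n} hn z => by
      obtain ⟨w, hw⟩ := hdiv n hn z.toMul
      exact ⟨Additive.ofMul w, hw⟩
  obtain ⟨t, ht⟩ := (Module.Baer.of_divisible (Additive Z)).extension_property j.toIntLinearMap hj
    LinearMap.id
  refine ⟨fun x => (t x).toMul, fun z => ?_, fun x y => ?_⟩
  · exact congrArg (fun f => (f (Additive.ofMul z)).toMul) ht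
  · have h1 : x * y = j (Additive.ofMul (b (p x) (p y) ^ e)) + (x + y) := by
      rw [add_def, add_def]
      simp [op, j, hpι]
    have h2 : t (j (Additive.ofMul (b (p x) (p y) ^ e))) = Additive.ofMul (b (p x) (p y) ^ e) :=
      congrArg (fun f => f (Additive.ofMul (b (p x) (p y) ^ e))) ht
    beta_reduce
    rw [h1, map_add t, map_add t, h2, toMul_add, toMul_add, toMul_ofMul, mul_comm]

theorem surjective_of_injective_pairing {k M : Type*} [Field k] [IsAlgClosed k] [CommGroup M]
    [Finite M] (hM : (Monoid.exponent M : k) ≠ 0) (b : M →* M →* kˣ)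
    (hb : Function.Injective b) : Function.Surjective b := by
  have : NeZero (Monoid.exponent M : k) := ⟨hM⟩
  have hcard := CommGroup.card_monoidHom_of_hasEnoughRootsOfUnity M k
  have : Finite (M →* kˣ) := Nat.finite_of_card_ne_zero (hcard ▸ Nat.card_pos.ne')
  exact (Nat.bijective_iff_injective_and_card b).mpr ⟨hb, hcard.symm⟩ |>.surjective

/-- `S` is the stabilizer of the quadratic section `t` under conjugation. Conjugation changes `t` by
a character of `M`; by duality some element of `A` causes the same change, so `S` supplements `A`.
An element `x` of `A` multiplies `t` by `b (p x)`, hence lies in `S` only if that is trivial. -/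
theorem exists_supplement_of_pairing {Γ M Z : Type*} [Group Γ] [CommGroup M] [CommGroup Z]
    (A : Subgroup Γ) [A.Normal] (p : A →* M) (hp : Function.Surjective p) (ι : Z →* A)
    (hι : Function.Injective ι) (hrange : ι.range = p.ker)
    (hcen : ∀ z (g : Γ), (ι z : Γ) * g = g * ι z)
    (b : M →* M →* Z) (hb : ∀ x y, x * y = ι (b (p x) (p y)) * (y * x))
    (hdual : Function.Surjective b)
    (hdiv : ∀ n : ℤ, n ≠ 0 → ∀ z : Z, ∃ w, w ^ n = z) (e : ℕ) (he : ∀ x y, b x y ^ (2 * e) = b x y) :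
    ∃ S : Subgroup Γ, (∀ z, (ι z : Γ) ∈ S) ∧ S ⊔ A = ⊤ ∧ ∀ x : A, (x : Γ) ∈ S → b (p x) = 1 := by
  have hpι (z : Z) : p (ι z) = 1 := by
    rw [← MonoidHom.mem_ker, ← hrange]
    exact ⟨z, rfl⟩
  have hcenA (z : Z) (a : A) : ι z * a = a * ι z := Subtype.ext (hcen z a)
  obtain ⟨t, htι, ht⟩ := exists_quadratic_section p ι hι hpι hcenA b hb hdiv e he
  have hconjι (g : Γ) (z : Z) : (MulAut.conjNormal g : MulAut A) (ι z) = ι z := by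
    ext
    rw [MulAut.conjNormal_apply, ← hcen, mul_inv_cancel_right]
  have hbconj (g : Γ) (x y : A) : b (p ((MulAut.conjNormal g : MulAut A) x))
      (p ((MulAut.conjNormal g : MulAut A) y)) = b (p x) (p y) :=
    pairing_equivariant p ι hι b hb _ (hconjι g) x y
  have htmul (z : Z) (x : A) : t (ι z * x) = z * t x := by
    rw [ht, htι, hpι, map_one, MonoidHom.one_apply, one_pow, mul_one]
  have htconj (a x : A) : t ((MulAut.conjNormal (a : Γ) : MulAut A) x) = b (p a) (p x) * t x := by
    rw [← htmul]
    congr 1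
    ext
    have := congrArg Subtype.val (hb a x)
    simp only [Subgroup.coe_mul] at this
    rw [MulAut.conjNormal_apply, this, Subgroup.coe_mul, mul_assoc, mul_inv_cancel_right]
  let S : Subgroup Γ :=
    { carrier := {g | ∀ x : A, t ((MulAut.conjNormal g : MulAut A) x) = t x}
      one_mem' := fun x => by simp
      mul_mem' := fun {g h} hg hh x => by
        rw [map_mul, MulAut.mul_apply, hg, hh]
      inv_mem' := fun {g} hg x => by
        rw [← hg, ← MulAut.mul_apply, ← map_mul, mul_inv_cancel, map_one, MulAut.one_apply] }
  have memS (g : Γ) : g ∈ S ↔ ∀ x : A, t ((MulAut.conjNormal g : MulAut A) x) = t x := Iff.rfl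
  refine ⟨S, fun z => ?_, ?_, fun x hx => ?_⟩
  · rw [memS]
    intro x
    congr 1
    ext
    rw [MulAut.conjNormal_apply, hcen, mul_inv_cancel_right]
  · rw [eq_top_iff]
    rintro g -
    -- The factors `b ^ e` cancel because `b` is conjugation invariant, so the quotient is
    -- multiplicative.
    let f : A →* Z := MonoidHom.mk' (fun x => t ((MulAut.conjNormal g : MulAut A) x) / t x) fun x y => by
      rw [map_mul, ht, ht, hbconj, mul_div_mul_right_eq_div, mul_div_mul_comm]
    have hf : p.ker ≤ f.ker := by
      rw [← hrange]
      rintro _ ⟨z, rfl⟩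
      change t _ / t _ = 1
      rw [hconjι, div_self']
    obtain ⟨m, hm⟩ := hdual (p.liftOfSurjective hp ⟨f, hf⟩)
    obtain ⟨a, rfl⟩ := hp m
    have hga (x : A) : t ((MulAut.conjNormal g : MulAut A) x) =
        t ((MulAut.conjNormal (a : Γ) : MulAut A) x) := by
      have h1 : (p.liftOfSurjective hp ⟨f, hf⟩) (p x) = f x :=
        MonoidHom.liftOfRightInverse_comp_apply _ _ _ _ _
      rw [htconj, hm, h1]
      exact (div_mul_cancel _ _).symm
    have hS : g * (a : Γ)⁻¹ ∈ S := by
      rw [memS]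
      intro x
      rw [map_mul, MulAut.mul_apply, hga, ← MulAut.mul_apply, ← map_mul, mul_inv_cancel, map_one,
        MulAut.one_apply]
    rw [← inv_mul_cancel_right g (a : Γ)]
    exact mul_mem (Subgroup.mem_sup_left hS) (Subgroup.mem_sup_right a.2)
  · ext m
    obtain ⟨y, rfl⟩ := hp m
    have := hx y
    rw [htconj, mul_eq_right] at this
    exact this

/-! ### Symplectic bases and the dimension bound -/

/-- Take a hyperbolic family of maximal size. A nonzero vector orthogonal to it would, by
nondegeneracy, have a partner orthogonal to it as well, and the pair would enlarge the family. -/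
theorem exists_symplectic_family {F V : Type*} [Field F] [AddCommGroup V] [Module F V]
    [FiniteDimensional F V] (B : LinearMap.BilinForm F V) (hB : B.IsAlt) (hnd : B.SeparatingLeft) :
    ∃ (n : ℕ) (v : Module.Basis (Fin n ⊕ Fin n) F V),
      LinearMap.BilinForm.toMatrix v B = Matrix.J (Fin n) F := by
  classical
  let P : ℕ → Prop := fun n => ∃ v : Fin n ⊕ Fin n → V, ∀ i j, B (v i) (v j) = Matrix.J (Fin n) F i j
  have hli {n : ℕ} {v : Fin n ⊕ Fin n → V} (hv : ∀ i j, B (v i) (v j) = Matrix.J (Fin n) F i j) :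
      LinearIndependent F v := by
    rw [Fintype.linearIndependent_iff]
    intro c hc
    have h1 : Matrix.vecMul c (Matrix.J (Fin n) F) = 0 := by
      ext j
      have := congrArg (fun u => B u (v j)) hc
      simpa [Matrix.vecMul, dotProduct, hv] using this
    have h2 : c = 0 := Matrix.vecMul_injective_of_isUnit
      ((Matrix.isUnit_iff_isUnit_det _).mpr (Matrix.isUnit_det_J _ _)) (by simpa using h1)
    simp [h2]
  have hbound : ∀ n, P n → n ≤ Module.finrank F V := by
    rintro n ⟨v, hv⟩
    have := (hli hv).fintype_card_le_finrank
    simp at this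
    omega
  obtain ⟨n, ⟨v, hv⟩, hmax⟩ : ∃ n, P n ∧ ∀ n', P n' → n' ≤ n := by
    have h0 : P 0 := ⟨fun _ => 0, fun i => by rcases i with i | i <;> exact i.elim0⟩
    exact ⟨Nat.findGreatest P (Module.finrank F V), Nat.findGreatest_spec (Nat.zero_le _) h0,
      fun n' hn' => Nat.le_findGreatest (hbound n' hn') hn'⟩
  let S : Submodule F V := Submodule.span F (Set.range v)
  -- Projection onto the orthogonal complement of the family; the signs follow `Matrix.J`, where
  -- `inr` against `inl` gives `+1`.
  let π : V → V := fun u => u - ∑ i : Fin n,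
    (B (v (Sum.inr i)) u • v (Sum.inl i) - B (v (Sum.inl i)) u • v (Sum.inr i))
  have hJ1 (i j : Fin n) : B (v (Sum.inl i)) (v (Sum.inl j)) = 0 := by simp [hv, Matrix.J]
  have hJ2 (i j : Fin n) : B (v (Sum.inr i)) (v (Sum.inr j)) = 0 := by simp [hv, Matrix.J]
  have hJ3 (i j : Fin n) : B (v (Sum.inr i)) (v (Sum.inl j)) = if i = j then 1 else 0 := by
    simp [hv, Matrix.J, Matrix.one_apply]
  have hJ4 (i j : Fin n) : B (v (Sum.inl i)) (v (Sum.inr j)) = if i = j then -1 else 0 := by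
    simp [hv, Matrix.J, Matrix.one_apply, neg_ite]
  have hπS (u : V) : u - π u ∈ S := by
    simp only [π, sub_sub_cancel]
    exact Submodule.sum_mem _ fun i _ => sub_mem
      (Submodule.smul_mem _ _ (Submodule.subset_span ⟨_, rfl⟩))
      (Submodule.smul_mem _ _ (Submodule.subset_span ⟨_, rfl⟩))
  have horth (u : V) (i) : B (v i) (π u) = 0 := by
    rcases i with i | i
    · simp [π, hJ1, hJ4, map_sub, map_sum]
    · simp [π, hJ2, hJ3, map_sub, map_sum]
  have horth' (u w : V) (hw : w ∈ S) : B w (π u) = 0 := by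
    induction hw using Submodule.span_induction with
    | mem x hx => obtain ⟨i, rfl⟩ := hx; exact horth u i
    | zero => simp
    | add x y _ _ hx hy => simp [hx, hy]
    | smul c x _ hx => simp [hx]
  have hneg (x y : V) : B x y = - B y x := (hB.neg_eq y x).symm
  have hπ0 (u : V) : π u = 0 := by
    by_contra hne
    obtain ⟨w, hw⟩ : ∃ w, B (π u) w ≠ 0 := by
      by_contra! hcon
      exact hne (hnd _ hcon)
    have hw1 : B (π w) (π u) ≠ 0 := by
      have : B (w - π w) (π u) = 0 := horth' u _ (hπS w)
      rw [map_sub B, LinearMap.sub_apply, sub_eq_zero] at this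
      rw [← this, hneg, neg_ne_zero]
      exact hw
    set x := π u
    set y := (B (π w) x)⁻¹ • π w
    have hyx : B y x = 1 := by simp [y, hw1]
    have hx0 (i) : B (v i) x = 0 := horth u i
    have hy0 (i) : B (v i) y = 0 := by simp [y, horth]
    have hx0' (i) : B x (v i) = 0 := by rw [hneg, hx0, neg_zero]
    have hy0' (i) : B y (v i) = 0 := by rw [hneg, hy0, neg_zero]
    have hxy : B x y = -1 := by rw [hneg, hyx]
    have : P (n + 1) := by
      refine ⟨Sum.elim (Fin.cons x fun i => v (Sum.inl i)) (Fin.cons y fun i => v (Sum.inr i)), ?_⟩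
      rintro (i | i) (j | j) <;> refine Fin.cases ?_ (fun i => ?_) i <;>
        refine Fin.cases ?_ (fun j => ?_) j <;>
        simp [Matrix.J, hx0, hy0, hx0', hy0', hyx, hxy, hJ1, hJ2, hJ3, hJ4, hB.self_eq_zero,
          Matrix.one_apply, neg_ite, Fin.succ_ne_zero, (Fin.succ_ne_zero _).symm]
    have := hmax _ this
    omega
  have hspan : ⊤ ≤ S := fun u _ => by simpa [hπ0 u] using hπS u
  refine ⟨n, Module.Basis.mk (hli hv) hspan, ?_⟩
  ext i j
  rw [LinearMap.BilinForm.toMatrix_apply, Module.Basis.mk_apply, Module.Basis.mk_apply, hv]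

theorem exists_embedsIrreduciblyInSp {G V : Type*} [Group G] [AddCommGroup V] [Module (ZMod 2) V]
    [Finite V] (φ : Representation (ZMod 2) G V) (hφ : Function.Injective φ) [Nontrivial V]
    (hirr : ∀ W : Submodule (ZMod 2) V, (∀ g, ∀ w ∈ W, φ g w ∈ W) → W = ⊥ ∨ W = ⊤)
    (B : LinearMap.BilinForm (ZMod 2) V) (hB : B.IsAlt) (hnd : B.SeparatingLeft)
    (hinv : ∀ g x y, B (φ g x) (φ g y) = B x y) :
    ∃ n, Nat.card V = 2 ^ (2 * n) ∧ EmbedsIrreduciblyInSp G n := by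
  obtain ⟨n, v, hv⟩ := exists_symplectic_family B hB hnd
  refine ⟨n, ?_, ?_⟩
  · have := Fintype.ofFinite V
    rw [Nat.card_eq_fintype_card, Module.card_fintype v]
    simp [two_mul]
  let f : G →* Matrix (Fin n ⊕ Fin n) (Fin n ⊕ Fin n) (ZMod 2) :=
    (LinearMap.toMatrixAlgEquiv v).toMonoidHom.comp φ
  have hf (g : G) : f g ∈ Matrix.symplecticGroup (Fin n) (ZMod 2) := by
    rw [SymplecticGroup.mem_iff', ← hv]
    change Matrix.transpose (LinearMap.toMatrix v v (φ g)) * _ * LinearMap.toMatrix v v (φ g) = _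
    rw [← LinearMap.BilinForm.toMatrix_comp]
    congr 1
    ext x y
    exact hinv g x y
  let ρ : G →* Matrix.symplecticGroup (Fin n) (ZMod 2) := f.codRestrict _ hf
  have hsub : (Matrix.symplecticGroup (Fin n) (ZMod 2)).subtype.comp ρ = f := rfl
  refine ⟨ρ, fun g h hgh => ?_, ?_⟩
  · exact hφ ((LinearMap.toMatrixAlgEquiv v).injective (congrArg Subtype.val hgh))
  · rw [hsub]
    have := v.equivFun.symm.toEquiv.nontrivial
    refine (isIrreducible_iff_forall_submodule _).mpr ⟨this, fun W hW => ?_⟩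
    have heq (g : G) (x : V) : v.equivFun (φ g x) = matrixRep f g (v.equivFun x) :=
      (LinearMap.toMatrix_mulVec_repr v v (φ g) x).symm
    have := hirr (W.comap v.equivFun.toLinearMap) fun g w hw => by
      rw [Submodule.mem_comap, LinearEquiv.coe_coe] at hw ⊢
      rw [heq]
      exact hW g _ hw
    refine this.imp (fun h => ?_) (fun h => ?_)
    · rw [← Submodule.map_comap_eq_of_surjective (f := v.equivFun.toLinearMap)
        v.equivFun.surjective W, h, Submodule.map_bot]
    · rw [← Submodule.map_comap_eq_of_surjective (f := v.equivFun.toLinearMap)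
        v.equivFun.surjective W, h, Submodule.map_top, LinearEquiv.range]

/-- Under conjugation by `ρ a`, the operators `ρ (s x)` are eigenvectors in `End V` with distinct
characters `a ↦ b (p a) x`. -/
theorem card_le_finrank_sq_of_pairing {A M k V : Type*} [Group A] [CommGroup M] [Finite M] [Field k]
    [AddCommGroup V] [Module k V] [FiniteDimensional k V] [Nontrivial V]
    (p : A →* M) (hp : Function.Surjective p) (ι : kˣ →* A) (b : M →* M →* kˣ)
    (hb : ∀ x y, x * y = ι (b (p x) (p y)) * (y * x)) (hinj : Function.Injective b.flip)
    (ρ : A →* Module.End k V) (hρ : ∀ z, ρ (ι z) = (z : k) • 1) :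
    Nat.card M ≤ Module.finrank k V ^ 2 := by
  choose s hs using hp
  have hunit (a : A) : ρ a * ρ a⁻¹ = 1 := by rw [← map_mul, mul_inv_cancel, map_one]
  have hli : LinearIndependent k fun x : M => ρ (s x) := by
    refine linearIndependent_of_characters (A := A)
      (fun x => ((Units.coeHom k).comp (b.flip x)).comp p) ?_
      (fun a => LinearMap.mulLeftRight k (ρ a, ρ a⁻¹)) _ ?_ ?_
    · intro x y hxy
      refine hinj (MonoidHom.ext fun m => Units.ext ?_)
      rw [← hs m]
      exact DFunLike.congr_fun hxy (s m)
    · intro x hx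
      have := hunit (s x)
      rw [hx, zero_mul] at this
      exact zero_ne_one this
    · intro x a
      rw [LinearMap.mulLeftRight_apply, ← map_mul, hb, hs, map_mul, map_mul, hρ, mul_assoc, mul_assoc,
        hunit, mul_one, smul_mul_assoc, one_mul]
      rfl
  have := Fintype.ofFinite M
  rw [Nat.card_eq_fintype_card, pow_two, ← Module.finrank_linearMap k k V V]
  exact hli.fintype_card_le_finrank

/-! ### The kernel of a minimal extension and its minimal normal subgroups -/

theorem le_frattini_of_isFiniteMinimalExtension {G H : Type*} [Group G] [Group H] {γ : H →* G}
    (hγ : IsFiniteMinimalExtension γ) : γ.ker ≤ frattini H := by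
  refine le_iInf₂ fun K hK => ?_
  by_contra hle
  have htop : K ⊔ γ.ker = ⊤ := hK.2 _ (left_lt_sup.mpr hle)
  have hmap : K.map γ = (⊤ : Subgroup H).map γ :=
    Subgroup.map_eq_map_iff.mpr (by rw [htop, top_sup_eq])
  have hlt := hγ.map_lt_top K hK.lt_top
  rw [hmap, Subgroup.map_top_of_surjective γ hγ.surjective] at hlt
  exact lt_irrefl _ hlt

theorem exists_minimal_normal_central {H : Type*} [Group H] [Finite H] (N : Subgroup H) [N.Normal]
    [Group.IsNilpotent N] (hN : N ≠ ⊥) :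
    ∃ (r : ℕ) (M : Subgroup H), r.Prime ∧ M.Normal ∧ M ≠ ⊥ ∧ M ≤ N ∧ (∀ x ∈ M, x ^ r = 1) ∧
      (∀ x ∈ M, ∀ y ∈ N, x * y = y * x) ∧ ∀ K : Subgroup H, K.Normal → K ≤ M → K = ⊥ ∨ K = M := by
  have : Nontrivial N := (Subgroup.nontrivial_iff_ne_bot N).mpr hN
  have hZ : Nontrivial (Subgroup.center N) :=
    (Subgroup.nontrivial_iff_ne_bot _).mpr (Group.IsNilpotent.center_ne_bot N)
  obtain ⟨r, hr, hdvd⟩ := Nat.exists_prime_and_dvd (Finite.one_lt_card (α := Subgroup.center N)).ne'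
  have : Fact r.Prime := ⟨hr⟩
  obtain ⟨z, hz⟩ := exists_prime_orderOf_dvd_card' r hdvd
  -- The elements of the centre of `N` killed by `r`; `M` is a minimal normal subgroup of `H` inside
  -- it.
  let Ω : Subgroup H :=
    { carrier := {x | x ∈ N ∧ (∀ y ∈ N, x * y = y * x) ∧ x ^ r = 1}
      one_mem' := ⟨one_mem _, by simp, one_pow _⟩
      mul_mem' := by
        rintro x y ⟨hx, hxc, hxr⟩ ⟨hy, hyc, hyr⟩
        refine ⟨mul_mem hx hy, fun w hw => ?_, ?_⟩
        · rw [mul_assoc, hyc w hw, ← mul_assoc, hxc w hw, mul_assoc]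
        · rw [(show Commute x y from hxc y hy).mul_pow, hxr, hyr, one_mul]
      inv_mem' := by
        rintro x ⟨hx, hxc, hxr⟩
        exact ⟨inv_mem hx, fun w hw => ((show Commute x w from hxc w hw).inv_left).eq,
          by rw [inv_pow, hxr, inv_one]⟩ }
  have hΩn : Ω.Normal := by
    refine ⟨?_⟩
    rintro x ⟨hx, hxc, hxr⟩ g
    refine ⟨Subgroup.Normal.conj_mem ‹_› x hx g, fun w hw => ?_, by rw [conj_pow, hxr]; group⟩
    have h1 := hxc (g⁻¹ * w * g) (by simpa using Subgroup.Normal.conj_mem ‹N.Normal› w hw g⁻¹)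
    calc g * x * g⁻¹ * w = g * (x * (g⁻¹ * w * g)) * g⁻¹ := by group
      _ = w * (g * x * g⁻¹) := by rw [h1]; group
  have hΩ : Ω ≠ ⊥ := by
    rw [Subgroup.ne_bot_iff_exists_ne_one]
    refine ⟨⟨((z : N) : H), (z : N).2, fun y hy => ?_, ?_⟩, fun h => ?_⟩
    · exact congrArg Subtype.val (Subgroup.mem_center_iff.mp z.2 ⟨y, hy⟩).symm
    · have := pow_orderOf_eq_one z
      rw [hz] at this
      exact congrArg (fun w : Subgroup.center N => ((w : N) : H)) this
    · have h1 : z = 1 := Subtype.ext (Subtype.ext (congrArg (fun w : Ω => (w : H)) h))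
      rw [h1, orderOf_one] at hz
      exact hr.one_lt.ne hz
  obtain ⟨M, ⟨hMn, hM0, hMΩ⟩, hmin⟩ := WellFounded.has_min (wellFounded_lt (α := Subgroup H))
    {K | K.Normal ∧ K ≠ ⊥ ∧ K ≤ Ω} ⟨Ω, hΩn, hΩ, le_rfl⟩
  refine ⟨r, M, hr, hMn, hM0, fun x hx => (hMΩ hx).1, fun x hx => (hMΩ hx).2.2,
    fun x hx => (hMΩ hx).2.1, fun K hK hKM => or_iff_not_imp_left.mpr fun hK0 => ?_⟩
  by_contra hne
  exact hmin K ⟨hK, hK0, hKM.trans hMΩ⟩ (lt_of_le_of_ne hKM hne)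

/-- As `M` has exponent two, `b` takes values `±1`, and reading these in `ZMod 2` turns `b` into an
invariant symplectic form. -/
theorem exists_embedsIrreduciblyInSp_of_pairing {G M k : Type*} [Group G] [CommGroup M] [Finite M]
    [Nontrivial M] [Field k] (hM : ∀ x : M, x ^ 2 = 1) (φ : G →* MulAut M)
    (hφ : Function.Injective φ)
    (hirr : ∀ K : Subgroup M, (∀ g, ∀ x ∈ K, φ g x ∈ K) → K = ⊥ ∨ K = ⊤) (b : M →* M →* kˣ)
    (hself : ∀ x, b x x = 1) (hinj : Function.Injective b)
    (hinv : ∀ g x y, b (φ g x) (φ g y) = b x y) :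
    ∃ n, Nat.card M = 2 ^ (2 * n) ∧ EmbedsIrreduciblyInSp G n := by
  classical
  let _ : Module (ZMod 2) (Additive M) := AddCommGroup.zmodModule fun x => hM x.toMul
  let f : M → M → ZMod 2 := fun x y => if b x y = 1 then 0 else 1
  have hsq (x y : M) : b x y * b x y = 1 := by
    rw [← pow_two, ← map_pow, hM, map_one]
  have hsign (x y : M) (h : b x y ≠ 1) : b x y = -1 := by
    refine Units.ext ((mul_self_eq_one_iff.mp (congrArg Units.val (hsq x y))).resolve_left ?_)
    exact fun h' => h (Units.ext h')
  have hmul {u v : kˣ} (hu : u ≠ 1 → u = -1) (hv : v ≠ 1 → v = -1) :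
      (if u * v = 1 then (0 : ZMod 2) else 1) =
        (if u = 1 then 0 else 1) + (if v = 1 then 0 else 1) := by
    by_cases h : u = 1
    · simp [h]
    by_cases h' : v = 1
    · simp [h']
    · rw [if_neg h, if_neg h', if_pos (by rw [hu h, hv h', neg_mul_neg, one_mul])]
      rfl
  have hf1 (x x' y : M) : f (x * x') y = f x y + f x' y := by
    simp only [f, map_mul, MonoidHom.mul_apply]
    exact hmul (hsign x y) (hsign x' y)
  have hf2 (x y y' : M) : f x (y * y') = f x y + f x y' := by
    simp only [f, map_mul]
    exact hmul (hsign x y) (hsign x y')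
  let B0 : Additive M →+ Additive M →+ ZMod 2 :=
    AddMonoidHom.mk' (fun x => AddMonoidHom.mk' (fun y => f x.toMul y.toMul) fun y y' => hf2 _ _ _)
      fun x x' => AddMonoidHom.ext fun y => hf1 _ _ _
  let B : LinearMap.BilinForm (ZMod 2) (Additive M) :=
    LinearMap.mk₂ (ZMod 2) (fun x y => B0 x y) (by simp) (fun c x y => by
      exact ZMod.map_smul (B0.flip y) c x) (by simp) (fun c x y => ZMod.map_smul (B0 x) c y)
  let ψ : Representation (ZMod 2) G (Additive M) :=
    { toFun := fun g => AddMonoidHom.toZModLinearMap 2 (MonoidHom.toAdditive (φ g).toMonoidHom)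
      map_one' := by ext x; simp
      map_mul' := fun g h => by ext x; simp }
  have hψ (g : G) (x : Additive M) : ψ g x = Additive.ofMul (φ g x.toMul) := rfl
  refine exists_embedsIrreduciblyInSp (V := Additive M) ψ ?_ ?_ B ?_ ?_ ?_
  · intro g h hgh
    exact hφ (MulEquiv.ext fun x => congrArg Additive.toMul (DFunLike.congr_fun hgh (Additive.ofMul x)))
  · intro W hW
    have := hirr (AddSubgroup.toSubgroup' W.toAddSubgroup) fun g x hx => hW g (Additive.ofMul x) hx
    refine this.imp (fun h => ?_) fun h => ?_
    · rw [Submodule.eq_bot_iff]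
      intro x hx
      have : x.toMul ∈ AddSubgroup.toSubgroup' W.toAddSubgroup := hx
      rw [h] at this
      exact this
    · rw [eq_top_iff]
      intro x _
      have : x.toMul ∈ AddSubgroup.toSubgroup' W.toAddSubgroup := by rw [h]; trivial
      exact this
  · intro x
    exact if_pos (hself _)
  · intro x hx
    refine hinj (MonoidHom.ext fun y => ?_ : b x.toMul = b 1)
    have : f x.toMul y = 0 := hx (Additive.ofMul y)
    by_contra h
    rw [map_one] at h
    exact one_ne_zero ((if_neg h).symm.trans this)
  · intro g x y
    change f _ _ = f _ _
    simp only [f, hψ, toMul_ofMul, hinv]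

/-! ### Divisibility of `kˣ` and linearization of `lam` -/

theorem IsAlgClosed.exists_zpow_units_eq {k : Type*} [Field k] [IsAlgClosed k] {n : ℤ} (hn : n ≠ 0)
    (z : kˣ) : ∃ w : kˣ, w ^ n = z := by
  have hroot (j : ℕ) (hj : 0 < j) : ∃ w : kˣ, w ^ j = z := by
    obtain ⟨w, hw⟩ := IsAlgClosed.exists_pow_nat_eq (z : k) hj
    have hw0 : w ≠ 0 := by
      rintro rfl
      rw [zero_pow hj.ne'] at hw
      exact z.ne_zero hw.symm
    exact ⟨Units.mk0 w hw0, Units.ext hw⟩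
  obtain ⟨w, hw⟩ := hroot n.natAbs (Int.natAbs_pos.mpr hn)
  rcases Int.natAbs_eq n with h | h
  · exact ⟨w, by rw [h, zpow_natCast, hw]⟩
  · exact ⟨w⁻¹, by rw [h, zpow_neg, zpow_natCast, inv_pow, inv_inv, hw]⟩

universe u v

/-- `Γ` is the fibre product of `GL_m(k)` and `H` over `PGL_m(k)`, acting through its first factor.
-/
theorem exists_linear_cover {H : Type u} {k : Type v} [Group H] [Field k] {m : ℕ} (lam : H →* PGL(m, k))
    (hlam : IsIrreducibleProj lam) :
    ∃ (Γ : Type (max u v)) (_ : Group Γ) (p : Γ →* H) (ι : kˣ →* Γ)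
      (ρ : Γ →* Module.End k (Fin m → k)),
      Function.Surjective p ∧ ι.range = p.ker ∧ (∀ z g, ι z * g = g * ι z) ∧
      (∀ z, ρ (ι z) = (z : k) • 1) ∧
      (∀ W : Submodule k (Fin m → k), (∀ g, ∀ w ∈ W, ρ g w ∈ W) → W = ⊥ ∨ W = ⊤) ∧
      (∀ g (z : k), ρ g = z • 1 → lam (p g) = 1) := by
  let Γ : Subgroup (GL (Fin m) k × H) :=
    ((Matrix.ProjGenLinGroup.mk).comp (MonoidHom.fst (GL (Fin m) k) H)).eqLocus
      (lam.comp (MonoidHom.snd (GL (Fin m) k) H))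
  have hΓ (g : Γ) : Matrix.ProjGenLinGroup.mk g.1.1 = lam g.1.2 := g.2
  let ι₀ : kˣ →* GL (Fin m) k × H := (Matrix.GeneralLinearGroup.scalar (Fin m)).prod 1
  let ι : kˣ →* Γ := ι₀.codRestrict Γ fun z => by
    change Matrix.ProjGenLinGroup.mk (Matrix.GeneralLinearGroup.scalar (Fin m) z) = lam 1
    rw [Matrix.ProjGenLinGroup.mk_scalar, map_one]
  let rep : Representation k (GL (Fin m) k) (Fin m → k) :=
    matrixRep (Units.coeHom (Matrix (Fin m) (Fin m) k))
  refine ⟨Γ, inferInstance, (MonoidHom.snd _ _).comp Γ.subtype, ι,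
    rep.comp ((MonoidHom.fst _ _).comp Γ.subtype), ?_, ?_, ?_, ?_, ?_, ?_⟩
  · intro h
    obtain ⟨B, hB⟩ := Matrix.ProjGenLinGroup.mk_surjective (lam h)
    exact ⟨⟨(B, h), hB⟩, rfl⟩
  · ext g
    constructor
    · rintro ⟨z, rfl⟩
      rfl
    · intro hg
      have hg : g.1.2 = 1 := hg
      have h1 := hΓ g
      rw [hg, map_one, Matrix.ProjGenLinGroup.mk_eq_one,
        Matrix.GeneralLinearGroup.center_eq_range_scalar] at h1
      obtain ⟨z, hz⟩ := h1
      exact ⟨z, Subtype.ext (Prod.ext hz hg.symm)⟩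
  · intro z g
    refine Subtype.ext (Prod.ext ?_ ?_)
    · have : Matrix.GeneralLinearGroup.scalar (Fin m) z ∈ Subgroup.center (GL (Fin m) k) := by
        rw [Matrix.GeneralLinearGroup.center_eq_range_scalar]
        exact ⟨z, rfl⟩
      exact (Subgroup.mem_center_iff.mp this g.1.1).symm
    · change 1 * g.1.2 = g.1.2 * 1
      rw [one_mul, mul_one]
  · intro z
    refine LinearMap.ext fun v => ?_
    change Matrix.mulVec (Matrix.scalar (Fin m) (z : k)) v = (z : k) • v
    ext i
    simp [Matrix.mulVec_diagonal]
  · intro W hW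
    refine ((isIrreducible_iff_forall_submodule _).mp hlam).2 W fun g w hw => ?_
    obtain ⟨h, hh⟩ := g.2
    exact hW ⟨(g.1, h), hh.symm⟩ w hw
  · intro g z hz
    change lam g.1.2 = 1
    rw [← hΓ, Matrix.ProjGenLinGroup.mk_eq_one, Subgroup.mem_center_iff]
    intro B
    have hcomm : rep (B * g.1.1) = rep (g.1.1 * B) := by
      have hz : rep g.1.1 = z • 1 := hz
      rw [map_mul, map_mul, hz, mul_smul_comm, smul_mul_assoc, one_mul, mul_one]
    refine Units.ext ((Matrix.toLinAlgEquiv' : Matrix (Fin m) (Fin m) k ≃ₐ[k] _).injective hcomm)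

/-! ### The main argument -/

theorem ker_eq_bot_of_isIrreducibleProj {G H k : Type*} [Group G] [Finite G] [IsSimpleGroup G]
    [Group H] (γ : H →* G) (hγ : IsFiniteMinimalExtension γ)
    [Field k] [IsAlgClosed k] (m : ℕ) (lam : H →* PGL(m, k)) (hlam : IsIrreducibleProj lam)
    (hP : m < minPermDegree G) (hn : ringChar k ≠ 2 → m < 2 ^ minSympRank G)
    (hbot : γ.ker ⊓ lam.ker = ⊥) : γ.ker = ⊥ := by
  by_contra hN
  have hfin : Finite H := hγ.finite
  have hnil : Group.IsNilpotent γ.ker := by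
    have := frattini_nilpotent (G := H)
    exact Group.nilpotent_of_mulEquiv (Subgroup.subgroupOfEquivOfLe
      (le_frattini_of_isFiniteMinimalExtension hγ))
  obtain ⟨r, M, hr, hMn, hM0, hMN, hMr, hMc, hMmin⟩ := exists_minimal_normal_central γ.ker hN
  obtain ⟨Γ, _, p, ι, ρ, hp, hrange, hcen, hρι, hirr, hscal⟩ := exists_linear_cover lam hlam
  have hV : Nontrivial (Fin m → k) := ((isIrreducible_iff_forall_submodule _).mp hlam).1
  have hpι (z : kˣ) : p (ι z) = 1 := by
    rw [← MonoidHom.mem_ker, ← hrange]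
    exact ⟨z, rfl⟩
  have hι : Function.Injective ι := fun z w h => by
    have h1 := congrArg ρ h
    rw [hρι, hρι] at h1
    exact Units.ext (smul_left_injective k (one_ne_zero (α := Module.End k (Fin m → k))) h1)
  have hq : Function.Surjective (γ.comp p) := hγ.surjective.comp hp
  -- Minimality of `H` over `G` passes to those subgroups of `Γ` that contain the central `kˣ`.
  have hminimal (S : Subgroup Γ) (hS : ∀ z, ι z ∈ S) (hSq : S.map (γ.comp p) = ⊤) : S = ⊤ := by
    have h1 : S.map p = ⊤ := by
      by_contra hne
      have := hγ.map_lt_top _ (lt_top_iff_ne_top.mpr hne)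
      rw [Subgroup.map_map, hSq] at this
      exact lt_irrefl _ this
    have h2 : p.ker ≤ S := by
      rw [← hrange]
      rintro _ ⟨z, rfl⟩
      exact hS z
    rw [← Subgroup.comap_map_eq_self h2, h1, Subgroup.comap_top]
  let _ : CommGroup M :=
    { (inferInstance : Group M) with
      mul_comm := fun x y => Subtype.ext (hMc x x.2 y (hMN y.2)) }
  have hMnt : Nontrivial M := (Subgroup.nontrivial_iff_ne_bot M).mpr hM0
  let A : Subgroup Γ := M.comap p
  let pM : A →* M := p.subgroupComap M
  have hpM : Function.Surjective pM := p.subgroupComap_surjective_of_surjective M hp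
  let ιA : kˣ →* A := ι.codRestrict A fun z => by
    change p (ι z) ∈ M
    rw [hpι]
    exact one_mem M
  have hιA : Function.Injective ιA := fun z w h => hι (congrArg Subtype.val h)
  have hrangeA : ιA.range = pM.ker := by
    ext x
    have : (x : Γ) ∈ ι.range ↔ (x : Γ) ∈ p.ker := by rw [hrange]
    constructor
    · rintro ⟨z, rfl⟩
      exact Subtype.ext (hpι z)
    · intro hx
      obtain ⟨z, hz⟩ := this.mpr (congrArg Subtype.val hx)
      exact ⟨z, Subtype.ext hz⟩
  obtain ⟨b, hb⟩ := exists_commutator_pairing pM hpM ιA hιA hrangeA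
    fun z a => Subtype.ext (hcen z a)
  have hself (x : M) : b x x = 1 := by
    obtain ⟨x, rfl⟩ := hpM x
    exact pairing_self pM ιA hιA b hb x
  have hskew (x y : M) : b y x = (b x y)⁻¹ := by
    obtain ⟨x, rfl⟩ := hpM x
    obtain ⟨y, rfl⟩ := hpM y
    exact pairing_skew pM ιA hιA b hb x y
  have hbinv (h : H) (x y : M) : b ((MulAut.conjNormal h : MulAut M) x)
      ((MulAut.conjNormal h : MulAut M) y) = b x y := by
    obtain ⟨x, rfl⟩ := hpM x
    obtain ⟨y, rfl⟩ := hpM y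
    obtain ⟨g, rfl⟩ := hp h
    have hconj (x : A) : (MulAut.conjNormal (p g) : MulAut M) (pM x) =
        pM ((MulAut.conjNormal g : MulAut A) x) := by
      ext
      rw [MulAut.conjNormal_apply]
      change _ = p ((MulAut.conjNormal g : MulAut A) x : Γ)
      rw [MulAut.conjNormal_apply, map_mul, map_mul, map_inv]
      rfl
    rw [hconj, hconj]
    refine pairing_equivariant pM ιA hιA b hb _ (fun z => Subtype.ext ?_) x y
    rw [MulAut.conjNormal_apply]
    change g * ι z * g⁻¹ = ι z
    rw [← hcen, mul_inv_cancel_right]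
  have hradical : b.ker = ⊥ ∨ b.ker = ⊤ := by
    have hnormal : (b.ker.map M.subtype).Normal := by
      refine ⟨?_⟩
      rintro _ ⟨x, hx, rfl⟩ h
      refine ⟨(MulAut.conjNormal h : MulAut M) x, ?_, MulAut.conjNormal_apply _ _⟩
      refine MonoidHom.ext fun y => ?_
      have h1 := hbinv h x ((MulAut.conjNormal h : MulAut M)⁻¹ y)
      rw [MulAut.apply_inv_self, (hx : b x = 1)] at h1
      exact h1
    refine (hMmin _ hnormal (Subgroup.map_subtype_le _)).imp (fun h => ?_) fun h => ?_
    · exact (Subgroup.map_eq_bot_iff_of_injective _ M.subtype_injective).mp h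
    · rw [eq_top_iff]
      rintro x -
      obtain ⟨y, hy, hyx⟩ : (x : H) ∈ b.ker.map M.subtype := by rw [h]; exact x.2
      rwa [← Subtype.ext hyx]
  have hnotriv (h : b = 1) : False := by
    have hA : ∀ x ∈ A, ∀ y ∈ A, Commute (ρ x) (ρ y) := by
      intro x hx y hy
      have := hb ⟨x, hx⟩ ⟨y, hy⟩
      rw [h, MonoidHom.one_apply, MonoidHom.one_apply, map_one, one_mul] at this
      rw [commute_iff_eq, ← map_mul, ← map_mul]
      exact congrArg (fun a : A => ρ a) this
    have hscalar := isScalar_of_commuting_normal ρ hirr A hA fun S hS hS0 hSm => by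
      refine hminimal S (fun z => hS _ ⟨z, hρι z⟩) ?_
      by_contra hne
      have h1 := minPermDegree_le_index _ hne
      have h2 := Nat.le_of_dvd (Nat.pos_of_ne_zero hS0) (S.index_map_dvd hq)
      rw [Module.finrank_fin_fun] at hSm
      omega
    apply hM0
    rw [eq_bot_iff]
    intro x hx
    obtain ⟨a, rfl⟩ := hp x
    obtain ⟨z, hz⟩ := hscalar a hx
    rw [← hbot]
    exact ⟨hMN hx, hscal a z hz⟩
  have hker : b.ker = ⊥ := hradical.resolve_right fun h => hnotriv
    (MonoidHom.ext fun x => (h.symm ▸ Subgroup.mem_top x : x ∈ b.ker))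
  have hinj : Function.Injective b := (MonoidHom.ker_eq_bot_iff b).mp hker
  have hMr' (x : M) : x ^ r = 1 := Subtype.ext (hMr x x.2)
  have hbr (x y : M) : b x y ^ r = 1 := by rw [← map_pow, hMr', map_one]
  -- In characteristic `r` the only `r`-th root of unity is `1`, which would force `b = 1`.
  have hrk : (r : k) ≠ 0 := by
    intro h0
    have : CharP k r := (CharP.charP_iff_prime_eq_zero hr).mpr h0
    have : Fact r.Prime := ⟨hr⟩
    refine hnotriv (MonoidHom.ext fun x => MonoidHom.ext fun y => Units.ext ?_)
    refine frobenius_inj k r ?_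
    rw [frobenius_def, frobenius_def, ← Units.val_pow_eq_pow_val, hbr]
    simp
  rcases hr.eq_two_or_odd' with rfl | hodd
  · have hm := hn fun h => hrk (by have := ringChar.of_eq h; exact CharP.cast_eq_zero k 2)
    let φ : G →* MulAut M := γ.liftOfSurjective hγ.surjective ⟨MulAut.conjNormal, fun x hx => by
      refine MulEquiv.ext fun y => Subtype.ext ?_
      rw [MulAut.conjNormal_apply, ← hMc y y.2 x hx, mul_inv_cancel_right]
      rfl⟩
    have hφ (h : H) : φ (γ h) = MulAut.conjNormal h :=
      MonoidHom.liftOfRightInverse_comp_apply _ _ _ _ _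
    have hφirr (K : Subgroup M) (hK : ∀ g, ∀ x ∈ K, φ g x ∈ K) : K = ⊥ ∨ K = ⊤ := by
      have hnormal : (K.map M.subtype).Normal := by
        refine ⟨?_⟩
        rintro _ ⟨x, hx, rfl⟩ h
        refine ⟨φ (γ h) x, hK _ _ hx, ?_⟩
        rw [hφ]
        exact MulAut.conjNormal_apply _ _
      refine (hMmin _ hnormal (Subgroup.map_subtype_le _)).imp (fun h => ?_) fun h => ?_
      · exact (Subgroup.map_eq_bot_iff_of_injective _ M.subtype_injective).mp h
      · rw [eq_top_iff]
        rintro x -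
        obtain ⟨y, hy, hyx⟩ : (x : H) ∈ K.map M.subtype := by rw [h]; exact x.2
        rwa [← Subtype.ext hyx]
    have hφinj : Function.Injective φ := by
      rw [← MonoidHom.ker_eq_bot_iff]
      refine (IsSimpleGroup.eq_bot_or_eq_top_of_normal φ.ker inferInstance).resolve_right fun h => ?_
      have htriv (g : G) : φ g = 1 := (h.symm ▸ Subgroup.mem_top g : g ∈ φ.ker)
      -- A trivial irreducible action makes `M` cyclic, and an alternating pairing on a cyclic group
      -- is trivial.
      obtain ⟨x, hx⟩ := exists_ne (1 : M)
      have hz : Subgroup.zpowers x = ⊤ := by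
        refine (hφirr _ fun g y hy => ?_).resolve_left (by rwa [Subgroup.zpowers_eq_bot])
        rw [htriv]
        exact hy
      refine hx (hinj (MonoidHom.ext fun y => ?_))
      obtain ⟨i, rfl⟩ := Subgroup.mem_zpowers_iff.mp (hz.symm ▸ Subgroup.mem_top y : y ∈ _)
      rw [map_zpow, hself, one_zpow, map_one, MonoidHom.one_apply]
    obtain ⟨n, hcard, hemb⟩ := exists_embedsIrreduciblyInSp_of_pairing hMr' φ hφinj hφirr b hself
      hinj fun g x y => by
        obtain ⟨h, rfl⟩ := hγ.surjective g
        rw [hφ]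
        exact hbinv h x y
    have hflip : Function.Injective b.flip := fun x y hxy => hinj <| MonoidHom.ext fun w => by
      rw [hskew w x, hskew w y]
      exact congrArg (·⁻¹) (DFunLike.congr_fun hxy w)
    have hle := card_le_finrank_sq_of_pairing pM hpM ιA b hb hflip (ρ.comp A.subtype) hρι
    rw [hcard, Module.finrank_fin_fun, mul_comm, pow_mul] at hle
    have h1 : 2 ^ n ≤ m := (Nat.pow_le_pow_iff_left two_ne_zero).mp hle
    have h2 : minSympRank G ≤ n := Nat.sInf_le hemb
    have h3 : 2 ^ minSympRank G ≤ 2 ^ n := Nat.pow_le_pow_right two_pos h2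
    omega
  · have hexp : (Monoid.exponent M : k) ≠ 0 := by
      obtain ⟨c, hc⟩ := Monoid.exponent_dvd_of_forall_pow_eq_one hMr'
      intro h0
      rw [hc, Nat.cast_mul, h0, zero_mul] at hrk
      exact hrk rfl
    obtain ⟨e, he⟩ := hodd
    -- With `r = 2 * e + 1`, the exponent `e + 1` is one half modulo `r`.
    obtain ⟨S, hιS, hsup, hS⟩ := exists_supplement_of_pairing A pM hpM ιA hιA hrangeA
      (fun z g => hcen z g) b hb (surjective_of_injective_pairing hexp b hinj)
      (fun n hn z => IsAlgClosed.exists_zpow_units_eq hn z) (e + 1) (fun x y => by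
        rw [show 2 * (e + 1) = r + 1 by omega, pow_succ, hbr, one_mul])
    have hStop : S = ⊤ := by
      refine hminimal S hιS ?_
      have hA : A.map (γ.comp p) = ⊥ := by
        rw [eq_bot_iff]
        rintro _ ⟨x, hx, rfl⟩
        exact hMN hx
      have := congrArg (Subgroup.map (γ.comp p)) hsup
      rwa [Subgroup.map_sup, hA, sup_bot_eq, Subgroup.map_top_of_surjective _ hq] at this
    refine hnotriv (MonoidHom.ext fun x => ?_)
    obtain ⟨a, rfl⟩ := hpM x
    exact hS a (hStop ▸ Subgroup.mem_top _)

theorem corollary2 {G H k : Type*} [Group G] [Finite G] [IsSimpleGroup G]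
    (hG : ¬ IsMulCommutative G) [Group H] (γ : H →* G) (hγ : IsFiniteMinimalExtension γ)
    [Field k] [IsAlgClosed k] (m : ℕ) (lam : H →* PGL(m, k)) (hlam : IsIrreducibleProj lam)
    (hP : m < minPermDegree G) (hn : ringChar k ≠ 2 → m < 2 ^ minSympRank G) :
    γ.ker ≤ lam.ker := by
  -- Both maps factor through `H ⧸ L`, which is still a minimal extension of `G`, and the image of
  -- `lam` is unchanged.
  let L : Subgroup H := γ.ker ⊓ lam.ker
  let γ' : H ⧸ L →* G := QuotientGroup.lift L γ fun x hx => hx.1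
  let lam' : H ⧸ L →* PGL(m, k) := QuotientGroup.lift L lam fun x hx => hx.2
  have hγ' : IsFiniteMinimalExtension γ' := by
    have := hγ.finite
    refine ⟨inferInstance, fun g => ?_, fun K hK => ?_⟩
    · obtain ⟨h, rfl⟩ := hγ.surjective g
      exact ⟨h, rfl⟩
    · have hsurj := QuotientGroup.mk'_surjective L
      have hlt : K.comap (QuotientGroup.mk' L) < ⊤ := by
        rw [lt_top_iff_ne_top] at hK ⊢
        intro h
        apply hK
        rw [← Subgroup.map_comap_eq_self_of_surjective hsurj K, h,
          Subgroup.map_top_of_surjective _ hsurj]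
      have h1 : (K.comap (QuotientGroup.mk' L)).map (γ'.comp (QuotientGroup.mk' L)) < ⊤ :=
        hγ.map_lt_top _ hlt
      rwa [← Subgroup.map_map, Subgroup.map_comap_eq_self_of_surjective hsurj] at h1
  have hlam' : IsIrreducibleProj lam' := by
    have hpre : projPreimage lam' = projPreimage lam := by
      unfold projPreimage
      congr 1
      ext x
      constructor
      · rintro ⟨h, rfl⟩
        obtain ⟨h, rfl⟩ := QuotientGroup.mk_surjective h
        exact ⟨h, rfl⟩
      · rintro ⟨h, rfl⟩
        exact ⟨h, rfl⟩
    unfold IsIrreducibleProj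
    rw [hpre]
    exact hlam
  have hbot : γ'.ker ⊓ lam'.ker = ⊥ := by
    rw [eq_bot_iff]
    rintro x ⟨hx, hx'⟩
    obtain ⟨h, rfl⟩ := QuotientGroup.mk_surjective x
    exact (QuotientGroup.eq_one_iff h).mpr ⟨hx, hx'⟩
  have hker := ker_eq_bot_of_isIrreducibleProj γ' hγ' m lam' hlam' hP hn hbot
  intro x hx
  have : (x : H ⧸ L) ∈ γ'.ker := hx
  rw [hker, Subgroup.mem_bot, QuotientGroup.eq_one_iff] at this
  exact this.2
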